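/- Let $\mathbb T=\bigcup_{n\ge 0}\{0,1\}^n$ be the binary tree of finite binary words, let $(G_v)_{v\in\mathbb T}$ be i.i.d. standard Gaussian random variables on a probability space, and for $u\in\mathbb T$ let $X_u=\sum_{\varnothing<v\le u}G_v$, where $v$ runs over the nonempty prefixes of $u$ (including $u$ itself). For $\beta\in\mathbb R$ let $$Z_n(\beta)=\frac1{2^n}\sum_{|u|=n}e^{\beta X_u-\frac{\beta^2}{2}n}\,(X_u-\beta n),\qquad n\ge 0,$$ be the derivative martingale of the binary Gaussian branching random walk. Put $\beta_c=\sqrt{2\log 2}$, let $\beta\in(0,\beta_c)$ and $\gamma=(\beta_c/\beta)^2$. Then $Z_n(\beta)$ converges almost surely as $n\to\infty$ to a finite limit $Z_\beta$, and there exist constants $c>0$ and $C>0$, depending only on $\beta$, such that for all $x\ge 0$ $$\mathbb P(Z_\beta<-x)\ \ge\ C\,e^{-c\,x^{\gamma}}.$$ -/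

import Mathlib

/-- The critical inverse temperature `√(2 log 2)`. -/
noncomputable def criticalBeta : ℝ := Real.sqrt (2 * Real.log 2)

/-- The value `X_u` of the branching random walk at the vertex `u` of the binary tree: the sum of
the increments `G_v` over all `v ≠ ∅` on the path from the root to `u`. A vertex is a finite binary
word, and the nonempty ancestors of `u` (including `u`) are its prefixes of length
`1, …, u.length`. -/
def brwValue {Ω : Type*} (G : List Bool → Ω → ℝ) (u : List Bool) (ω : Ω) : ℝ :=
  ∑ k ∈ Finset.range u.length, G (u.take (k + 1)) ω

/-- The derivative martingale
`Z_n(β) = 2⁻ⁿ ∑_{|u| = n} exp (β X_u - β² n / 2) (X_u - β n)`.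
The words of length `n` are listed once each as `List.ofFn u` with `u : Fin n → Bool`. -/
noncomputable def derivMartingale {Ω : Type*} (G : List Bool → Ω → ℝ) (β : ℝ) (n : ℕ) (ω : Ω) : ℝ :=
  (1 / 2 ^ n : ℝ) * ∑ u : Fin n → Bool,
    Real.exp (β * brwValue G (List.ofFn u) ω - β ^ 2 / 2 * n) *
      (brwValue G (List.ofFn u) ω - β * n)

/-- `G` is a family of independent standard Gaussian random variables indexed by the vertices of
the binary tree. -/
structure IsStdGaussianTree {Ω : Type*} [MeasurableSpace Ω] (P : MeasureTheory.Measure Ω)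
    (G : List Bool → Ω → ℝ) : Prop where
  measurable : ∀ v, Measurable (G v)
  law : ∀ v, P.map (G v) = ProbabilityTheory.gaussianReal 0 1
  indep : ProbabilityTheory.iIndepFun G P

/-- `Z` is (a version of) the almost sure limit of the derivative martingale. -/
def IsDerivMartingaleLimit {Ω : Type*} [MeasurableSpace Ω] (P : MeasureTheory.Measure Ω)
    (G : List Bool → Ω → ℝ) (β : ℝ) (Z : Ω → ℝ) : Prop :=
  ∀ᵐ ω ∂P, Filter.Tendsto (fun n => derivMartingale G β n ω) Filter.atTop (nhds (Z ω))

universe u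

/-! Convergence. An increment of the martingale is a sum of coefficients depending on generations
`1, …, n` times centred, pairwise orthogonal noises of generation `n + 1`
(`derivMartingale_succ_sub`). The coefficients need not have well-behaved second moments, so the
variance is taken conditionally: the L¹ norm of such a sum is at most a constant times the mean of
`√(∑ a²)` (`integral_abs_sum_mul_le`). Interpolating this ℓ² norm with a `p`-th moment, `p > 1`
close to `1`, gives geometric decay, because the total `p`-th moment decays exponentially when `β <
βc` (`exists_momentRate_neg`). The increments are thus summable in L¹, which yields both the almost
sure limit and the martingale property of `Z - Z_k`.

Lower tail. If both first steps are at most `β`, then `Z ≤ ½ ∑_b exp (β G_b - β²/2) Z^(b)` with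
`Z^(b)` independent copies of `Z`. Asking that both steps lie in `[β - ε, β]` and both copies lie
below `-y` pushes `Z` below `-y exp (β²/2 - βε)`; hence the tail at this new level is at least a
constant times `ε² · tail(y)²` (`lowerTail_recursion`). With `ε = 2⁻ⁿ` at step `n` the losses in the
level are summable, and the tail at a level of order `exp (β² n / 2)` is at least `θ ^ 2ⁿ`. Since
`exp (β²/2) ^ γ = 2`, this is the claimed stretched exponential.

The recursion needs a starting level of positive probability. It exists because `Z_1 < 0` when both
first steps are below `β`, and `Z - Z_1` has mean zero on that event (`measure_limit_neg_pos`). -/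

namespace GaussianTree

open MeasureTheory ProbabilityTheory Filter Topology

/-! ### Decompositions of the derivative martingale at the last and the first generation -/

section Recursion

variable {Ω : Type*} (G : List Bool → Ω → ℝ) (β : ℝ)

theorem brwValue_append_singleton (u : List Bool) (b : Bool) (ω : Ω) :
    brwValue G (u ++ [b]) ω = brwValue G u ω + G (u ++ [b]) ω := by
  unfold brwValue
  rw [List.length_append, List.length_singleton, Finset.sum_range_succ]
  congr 1
  · refine Finset.sum_congr rfl fun k hk => ?_
    rw [List.take_append_of_le_length (by simpa [Nat.succ_le_iff] using hk)]
  · rw [List.take_of_length_le (by simp)]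

theorem brwValue_cons (u : List Bool) (b : Bool) (ω : Ω) :
    brwValue G (b :: u) ω = G [b] ω + brwValue (fun v => G (b :: v)) u ω := by
  unfold brwValue
  rw [List.length_cons, Finset.sum_range_succ', add_comm]
  simp

/-- The normalised weight `2^{-(n+1)} exp (β X_u - β² n / 2)` of a child of a vertex `u` of
generation `n`, before its own increment is taken into account. -/
noncomputable def childWeight (n : ℕ) (u : Fin n → Bool) (ω : Ω) : ℝ :=
  (1 / 2 ^ (n + 1) : ℝ) * Real.exp (β * brwValue G (List.ofFn u) ω - β ^ 2 / 2 * n)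

/-- The vertex of generation `n + 1` that is the child `p.2` of `p.1`. -/
def child {n : ℕ} (p : (Fin n → Bool) × Bool) : List Bool := List.ofFn p.1 ++ [p.2]

theorem child_injective {n : ℕ} : Function.Injective (child (n := n)) := by
  rintro ⟨u, b⟩ ⟨u', b'⟩ h
  simp only [child] at h
  obtain ⟨h1, h2⟩ := List.append_inj h (by simp)
  exact Prod.ext (List.ofFn_injective h1) (by simpa using h2)

theorem length_child {n : ℕ} (p : (Fin n → Bool) × Bool) : (child p).length = n + 1 := by
  simp [child]

/-- The centred exponential tilt of an increment. -/
noncomputable def tiltNoise (g : ℝ) : ℝ := Real.exp (β * g - β ^ 2 / 2) - 1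

/-- The derivative in `β` of the exponential tilt of an increment. -/
noncomputable def derivNoise (g : ℝ) : ℝ := Real.exp (β * g - β ^ 2 / 2) * (g - β)

theorem ofFn_snoc {n : ℕ} (u : Fin n → Bool) (b : Bool) :
    List.ofFn (Fin.snoc (α := fun _ => Bool) u b) = List.ofFn u ++ [b] := by
  rw [List.ofFn_succ']
  simp [List.concat_eq_append]

/-- With `E` the tilt of the new step `g` and `Y = X_u - βn`, this is `E (Y + g - β) - Y = Y (E - 1)
+ E (g - β)`, summed over children; both noises are centred. -/
theorem derivMartingale_succ_sub (n : ℕ) (ω : Ω) :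
    derivMartingale G β (n + 1) ω - derivMartingale G β n ω =
      ∑ p : (Fin n → Bool) × Bool,
          childWeight G β n p.1 ω * (brwValue G (List.ofFn p.1) ω - β * n) *
            tiltNoise β (G (child p) ω) +
        ∑ p : (Fin n → Bool) × Bool, childWeight G β n p.1 ω * derivNoise β (G (child p) ω) := by
  have h1 : derivMartingale G β (n + 1) ω = ∑ p : (Fin n → Bool) × Bool,
      (1 / 2 ^ (n + 1) : ℝ) * (Real.exp (β * (brwValue G (List.ofFn p.1) ω + G (child p) ω) -
        β ^ 2 / 2 * (n + 1 : ℕ)) *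
          (brwValue G (List.ofFn p.1) ω + G (child p) ω - β * (n + 1 : ℕ))) := by
    unfold derivMartingale
    rw [Finset.mul_sum, ← (Fin.snocEquiv (fun _ => Bool)).sum_comp]
    rw [← (Equiv.prodComm _ _).sum_comp]
    refine Finset.sum_congr rfl fun p _ => ?_
    simp only [Equiv.prodComm_apply, Fin.snocEquiv, Equiv.coe_fn_mk, Prod.fst_swap, Prod.snd_swap]
    rw [ofFn_snoc, brwValue_append_singleton]
    rfl
  have h2 : derivMartingale G β n ω = ∑ p : (Fin n → Bool) × Bool,
      childWeight G β n p.1 ω * (brwValue G (List.ofFn p.1) ω - β * n) := by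
    unfold derivMartingale childWeight
    rw [Fintype.sum_prod_type, Finset.mul_sum]
    refine Finset.sum_congr rfl fun u _ => ?_
    simp only [Finset.sum_const, Finset.card_univ, Fintype.card_bool, pow_succ]
    rw [nsmul_eq_mul]
    field_simp
    norm_num [mul_comm]
  rw [h1, h2, ← Finset.sum_sub_distrib, ← Finset.sum_add_distrib]
  refine Finset.sum_congr rfl fun p _ => ?_
  have : Real.exp (β * (brwValue G (List.ofFn p.1) ω + G (child p) ω) -
        β ^ 2 / 2 * (n + 1 : ℕ)) = Real.exp (β * brwValue G (List.ofFn p.1) ω - β ^ 2 / 2 * n) *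
          Real.exp (β * G (child p) ω - β ^ 2 / 2) := by
    rw [← Real.exp_add]; congr 1; push_cast; ring
  rw [this]
  simp only [childWeight, tiltNoise, derivNoise]
  push_cast
  ring

/-- The exact recursion also contains `(G_b - β)` times a positive sum of exponentials. The
hypothesis makes that term nonpositive, so it is dropped and the additive martingale never has to be
controlled. -/
theorem derivMartingale_succ_le (n : ℕ) (ω : Ω) (h : ∀ b, G [b] ω ≤ β) :
    derivMartingale G β (n + 1) ω ≤ (1 / 2 : ℝ) * ∑ b : Bool,
      Real.exp (β * G [b] ω - β ^ 2 / 2) * derivMartingale (fun v => G (b :: v)) β n ω := by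
  unfold derivMartingale
  rw [← (Fin.consEquiv (fun _ => Bool)).sum_comp, Fintype.sum_prod_type, Finset.mul_sum,
    Finset.mul_sum]
  refine Finset.sum_le_sum fun b _ => ?_
  rw [Finset.mul_sum, Finset.mul_sum, Finset.mul_sum, Finset.mul_sum]
  refine Finset.sum_le_sum fun u _ => ?_
  simp only [Fin.consEquiv, Equiv.coe_fn_mk, List.ofFn_cons, brwValue_cons]
  set X := brwValue (fun v => G (b :: v)) (List.ofFn u) ω
  have : Real.exp (β * (G [b] ω + X) - β ^ 2 / 2 * (n + 1 : ℕ)) =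
      Real.exp (β * G [b] ω - β ^ 2 / 2) * Real.exp (β * X - β ^ 2 / 2 * n) := by
    rw [← Real.exp_add]; congr 1; push_cast; ring
  rw [this]
  have e : (1 / 2 : ℝ) * (Real.exp (β * G [b] ω - β ^ 2 / 2) *
      (1 / 2 ^ n * (Real.exp (β * X - β ^ 2 / 2 * n) * (X - β * n)))) =
      (1 / 2 ^ (n + 1)) * (Real.exp (β * G [b] ω - β ^ 2 / 2) *
      Real.exp (β * X - β ^ 2 / 2 * n) * (X - β * n)) := by
    rw [pow_succ]; field_simp; ring
  rw [e]
  have := h b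
  refine mul_le_mul_of_nonneg_left ?_ (by positivity)
  refine (mul_le_mul_of_nonneg_left (?_ : _ ≤ X - β * n) (by positivity)).trans_eq rfl
  push_cast
  linarith

end Recursion

/-! ### L¹ bounds for sums of orthogonal noises with random coefficients -/

section Abstract

variable {Ω : Type*}

theorem integral_mul_of_indep {m m' mΩ : MeasurableSpace Ω} {P : Measure Ω} (hm : m ≤ mΩ) (hm' : m' ≤ mΩ)
    (hind : Indep m m' P) {f g : Ω → ℝ} (hf : Measurable[m] f) (hg : Measurable[m'] g) :
    ∫ ω, f ω * g ω ∂P = (∫ ω, f ω ∂P) * ∫ ω, g ω ∂P := by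
  have : IndepFun f g P := by
    rw [IndepFun_iff_Indep]
    exact indep_of_indep_of_le_left (indep_of_indep_of_le_right hind hg.comap_le) hf.comap_le
  exact this.integral_fun_mul_eq_mul_integral (hf.mono hm le_rfl).aestronglyMeasurable
    (hg.mono hm' le_rfl).aestronglyMeasurable

theorem integrable_mul_of_indep {m m' mΩ : MeasurableSpace Ω} {P : Measure Ω}
    (hind : Indep m m' P) {f g : Ω → ℝ} (hf : Measurable[m] f) (hg : Measurable[m'] g)
    (hfi : Integrable f P) (hgi : Integrable g P) :
    Integrable (fun ω => f ω * g ω) P := by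
  have : IndepFun f g P := by
    rw [IndepFun_iff_Indep]
    exact indep_of_indep_of_le_left (indep_of_indep_of_le_right hind hg.comap_le) hf.comap_le
  exact this.integrable_mul hfi hgi

/-- This is `(r - |s|)² ≥ 0` divided by `r`. Taking for `r` the ℓ² norm of the coefficients replaces
a conditional Jensen inequality. -/
theorem abs_le_half_add_sq_div {s r : ℝ} (hr : 0 ≤ r) (h : r = 0 → s = 0) :
    |s| ≤ (r + s ^ 2 / r) / 2 := by
  rcases hr.eq_or_lt with h0 | h0
  · simp [h h0.symm, ← h0]
  · rw [le_div_iff₀ two_pos, ← sub_nonneg]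
    have : r + s ^ 2 / r - |s| * 2 = (r - |s|) ^ 2 / r := by
      rw [← sq_abs s]; field_simp; ring
    rw [this]; positivity

/-- A conditional second moment bound for the first absolute moment of a sum of orthogonal noises
with independent random coefficients. -/
theorem integral_abs_sum_mul_le {ι : Type*} [Fintype ι] {m m' mΩ : MeasurableSpace Ω} {P : Measure Ω}
    (hm : m ≤ mΩ)
    (hm' : m' ≤ mΩ) (hind : Indep m m' P) {a Y : ι → Ω → ℝ} (ha : ∀ i, Measurable[m] (a i))
    (hai : ∀ i, Integrable (a i) P) (hY : ∀ i, Measurable[m'] (Y i)) (hYi : ∀ i, MemLp (Y i) 2 P)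
    {s : ℝ} (hvar : ∀ i, ∫ ω, Y i ω * Y i ω ∂P = s)
    (horth : ∀ i j, i ≠ j → ∫ ω, Y i ω * Y j ω ∂P = 0) :
    ∫ ω, |∑ i, a i ω * Y i ω| ∂P ≤ (1 + s) / 2 * ∫ ω, √(∑ i, a i ω ^ 2) ∂P := by
  classical
  set R : Ω → ℝ := fun ω => √(∑ i, a i ω ^ 2) with hR
  have hRm : Measurable[m] R :=
    (Finset.measurable_sum _ fun i _ => (ha i).pow_const 2).sqrt
  have hR0 : ∀ ω, 0 ≤ R ω := fun ω => Real.sqrt_nonneg _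
  have haR : ∀ i ω, |a i ω| ≤ R ω := fun i ω => by
    rw [← Real.sqrt_sq_eq_abs]
    exact Real.sqrt_le_sqrt (Finset.single_le_sum (f := fun i => a i ω ^ 2)
      (fun j _ => sq_nonneg _) (Finset.mem_univ i))
  have hRs : ∀ ω, R ω ^ 2 = ∑ i, a i ω ^ 2 := fun ω =>
    Real.sq_sqrt (Finset.sum_nonneg fun i _ => sq_nonneg _)
  have hRle : ∀ ω, R ω ≤ ∑ i, |a i ω| := fun ω => by
    refine Real.sqrt_le_iff.2 ⟨Finset.sum_nonneg fun i _ => abs_nonneg _, ?_⟩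
    simpa using Finset.sum_sq_le_sq_sum_of_nonneg (s := Finset.univ) (f := fun i => |a i ω|)
      (fun i _ => abs_nonneg _)
  have hRi : Integrable R P := by
    refine (integrable_finsetSum Finset.univ fun i _ => (hai i).abs).mono'
      (hRm.mono hm le_rfl).aestronglyMeasurable (ae_of_all _ fun ω => ?_)
    rw [Real.norm_of_nonneg (hR0 ω)]
    exact hRle ω
  have hYY : ∀ i j, Integrable (fun ω => Y i ω * Y j ω) P := fun i j =>
    (hYi i).integrable_mul (hYi j)
  have hcm : ∀ i j, Measurable[m] fun ω => a i ω * a j ω / R ω := fun i j =>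
    ((ha i).mul (ha j)).div hRm
  -- Dividing by `R` bounds `a i * a j / R` by `|a i|`, so first moments of the coefficients
  -- suffice.
  have hci : ∀ i j, Integrable (fun ω => a i ω * a j ω / R ω) P := fun i j => by
    refine (hai i).abs.mono' ((hcm i j).mono hm le_rfl).aestronglyMeasurable
      (ae_of_all _ fun ω => ?_)
    rw [Real.norm_eq_abs, abs_div, abs_mul, abs_of_nonneg (hR0 ω), mul_div_assoc]
    exact mul_le_of_le_one_right (abs_nonneg _) (div_le_one_of_le₀ (haR j ω) (hR0 ω))
  have hYm : ∀ i j, Measurable[m'] fun ω => Y i ω * Y j ω := fun i j => (hY i).mul (hY j)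
  have hprod : ∀ i j, Integrable (fun ω => a i ω * a j ω / R ω * (Y i ω * Y j ω)) P := fun i j =>
    integrable_mul_of_indep hind (hcm i j) (hYm i j) (hci i j) (hYY i j)
  have hexp : ∀ ω, (∑ i, a i ω * Y i ω) ^ 2 / R ω =
      ∑ i, ∑ j, a i ω * a j ω / R ω * (Y i ω * Y j ω) := fun ω => by
    rw [sq, Finset.sum_mul_sum, Finset.sum_div]
    refine Finset.sum_congr rfl fun i _ => ?_
    rw [Finset.sum_div]
    exact Finset.sum_congr rfl fun j _ => by ring
  have hquad : ∫ ω, (∑ i, a i ω * Y i ω) ^ 2 / R ω ∂P = s * ∫ ω, R ω ∂P := by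
    simp_rw [hexp]
    rw [integral_finsetSum _ fun i _ => integrable_finsetSum _ fun j _ => hprod i j]
    have : ∀ i, ∫ ω, ∑ j, a i ω * a j ω / R ω * (Y i ω * Y j ω) ∂P =
        s * ∫ ω, a i ω * a i ω / R ω ∂P := fun i => by
      rw [integral_finsetSum _ fun j _ => hprod i j, Finset.sum_eq_single i]
      · rw [integral_mul_of_indep hm hm' hind (hcm i i) (hYm i i), hvar, mul_comm]
      · intro j _ hj
        rw [integral_mul_of_indep hm hm' hind (hcm i j) (hYm i j), horth i j hj.symm, mul_zero]
      · simp
    simp_rw [this]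
    rw [← Finset.mul_sum, ← integral_finsetSum _ fun i _ => hci i i]
    congr 2
    funext ω
    rw [← Finset.sum_div]
    simp_rw [← sq]
    rw [← hRs, sq]
    by_cases h : R ω = 0
    · simp [h]
    · field_simp
  have hqi : Integrable (fun ω => (∑ i, a i ω * Y i ω) ^ 2 / R ω) P := by
    simp_rw [hexp]
    exact integrable_finsetSum _ fun i _ => integrable_finsetSum _ fun j _ => hprod i j
  calc ∫ ω, |∑ i, a i ω * Y i ω| ∂P
      ≤ ∫ ω, (R ω + (∑ i, a i ω * Y i ω) ^ 2 / R ω) / 2 ∂P := by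
        refine integral_mono_of_nonneg (ae_of_all _ fun ω => abs_nonneg _)
          ((hRi.add hqi).div_const 2) (ae_of_all _ fun ω => ?_)
        refine abs_le_half_add_sq_div (hR0 ω) fun h => Finset.sum_eq_zero fun i _ => ?_
        have := haR i ω
        rw [h] at this
        rw [abs_nonpos_iff.1 this, zero_mul]
    _ = (1 + s) / 2 * ∫ ω, R ω ∂P := by
        rw [integral_div, integral_add hRi hqi, hquad]; ring

/-- Interpolation between a constant and a `p`-th moment. -/
theorem sqrt_sum_sq_le {ι : Type*} (S : Finset ι) (a : ι → ℝ) {p t : ℝ} (hp1 : 1 ≤ p) (hp2 : p ≤ 2)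
    (ht : 0 < t) : √(∑ i ∈ S, a i ^ 2) ≤ t + t ^ (1 - p) * ∑ i ∈ S, |a i| ^ p := by
  set R := √(∑ i ∈ S, a i ^ 2) with hR
  have hs : 0 ≤ ∑ i ∈ S, |a i| ^ p := Finset.sum_nonneg fun i _ => Real.rpow_nonneg (abs_nonneg _) _
  rcases le_or_gt R t with h | h
  · have : 0 ≤ t ^ (1 - p) * ∑ i ∈ S, |a i| ^ p := mul_nonneg (Real.rpow_nonneg ht.le _) hs
    linarith
  have hR0 : 0 < R := ht.trans h
  have hsq : R ^ 2 = ∑ i ∈ S, a i ^ 2 := Real.sq_sqrt (Finset.sum_nonneg fun i _ => sq_nonneg _)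
  -- Each `|a i|` is at most `R`, so the surplus power `2 - p ≥ 0` can be traded for `R`.
  have hle : R ^ 2 ≤ R ^ (2 - p) * ∑ i ∈ S, |a i| ^ p := by
    rw [hsq, Finset.mul_sum]
    refine Finset.sum_le_sum fun i hi => ?_
    have hai : |a i| ≤ R := by
      rw [← Real.sqrt_sq_eq_abs]
      exact Real.sqrt_le_sqrt (Finset.single_le_sum (f := fun i => a i ^ 2)
        (fun j _ => sq_nonneg _) hi)
    rcases (abs_nonneg (a i)).eq_or_lt with h0 | h0
    · rw [abs_eq_zero.1 h0.symm, zero_pow two_ne_zero]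
      positivity
    · calc a i ^ 2 = |a i| ^ (2 - p) * |a i| ^ p := by
            rw [← Real.rpow_add h0, sub_add_cancel, Real.rpow_two, sq_abs]
        _ ≤ _ := by
            gcongr
  have : R ≤ R ^ (1 - p) * ∑ i ∈ S, |a i| ^ p := by
    have e : R ^ (2 - p) = R * R ^ (1 - p) := by
      nth_rw 2 [← Real.rpow_one R]
      rw [← Real.rpow_add hR0]
      congr 1
      ring
    rw [e, sq, mul_assoc] at hle
    exact le_of_mul_le_mul_left hle hR0
  refine this.trans ?_
  have h3 : R ^ (1 - p) ≤ t ^ (1 - p) := Real.rpow_le_rpow_of_nonpos ht h.le (by linarith)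
  nlinarith [mul_le_mul_of_nonneg_right h3 hs]

end Abstract

/-! ### Absorbing the polynomial factor, and the subcritical moment rate -/

section Parameters

/-- Trades the factor `X_u - βn` for a small shift `±δ` of the exponent, so that only Gaussian
Laplace transforms remain to be computed. -/
theorem one_add_sq_le_exp_add_exp {δ : ℝ} (hδ : 0 < δ) (y : ℝ) :
    1 + y ^ 2 ≤ (1 + 2 / δ ^ 2) * (Real.exp (δ * y) + Real.exp (-(δ * y))) := by
  have h1 : 1 + (δ * y) ^ 2 / 2 ≤ Real.exp (δ * y) + Real.exp (-(δ * y)) := by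
    have h := Real.quadratic_le_exp_of_nonneg (abs_nonneg (δ * y))
    rw [sq_abs] at h
    have h0 := abs_nonneg (δ * y)
    rcases abs_cases (δ * y) with ⟨h', _⟩ | ⟨h', _⟩ <;> rw [h'] at h h0 <;>
      linarith [Real.exp_pos (δ * y), Real.exp_pos (-(δ * y))]
  have h2 : 1 + y ^ 2 ≤ (1 + 2 / δ ^ 2) * (1 + (δ * y) ^ 2 / 2) := by
    have : (1 + 2 / δ ^ 2) * (1 + (δ * y) ^ 2 / 2) =
        1 + y ^ 2 + (2 / δ ^ 2 + (δ * y) ^ 2 / 2) := by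
      field_simp; ring
    rw [this]
    have : 0 ≤ 2 / δ ^ 2 + (δ * y) ^ 2 / 2 := by positivity
    linarith
  exact h2.trans (mul_le_mul_of_nonneg_left h1 (by positivity))

theorem abs_pow_rpow_le {p : ℝ} (hp1 : 1 ≤ p) (hp2 : p ≤ 2) {e : ℕ} (he : e ≤ 1) (y : ℝ) :
    |y ^ e| ^ p ≤ 1 + y ^ 2 := by
  interval_cases e
  · simp [sq_nonneg]
  · rw [pow_one]
    rcases le_total |y| 1 with h | h
    · have := Real.rpow_le_one (abs_nonneg y) h (by linarith : 0 ≤ p)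
      nlinarith [sq_nonneg y]
    · have := Real.rpow_le_rpow_of_exponent_le h hp2
      rw [Real.rpow_two, sq_abs] at this
      linarith

theorem abs_exp_mul_pow_rpow_le {p δ : ℝ} (hp1 : 1 ≤ p) (hp2 : p ≤ 2) (hδ : 0 < δ) {e : ℕ}
    (he : e ≤ 1) (β x N : ℝ) :
    |Real.exp (β * x - β ^ 2 / 2 * N) * (x - β * N) ^ e| ^ p ≤
      (1 + 2 / δ ^ 2) * (Real.exp ((p * β + δ) * x - (p * β ^ 2 / 2 + δ * β) * N) +
        Real.exp ((p * β - δ) * x - (p * β ^ 2 / 2 - δ * β) * N)) := by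
  rw [abs_mul, Real.abs_exp, Real.mul_rpow (Real.exp_pos _).le (abs_nonneg _), ← Real.exp_mul]
  have h := (abs_pow_rpow_le hp1 hp2 he (x - β * N)).trans
    (one_add_sq_le_exp_add_exp hδ (x - β * N))
  refine (mul_le_mul_of_nonneg_left h (Real.exp_pos _).le).trans_eq ?_
  rw [mul_left_comm, mul_add, ← Real.exp_add, ← Real.exp_add]
  ring_nf

/-- The exponential growth rate of the `p`-th moments of the coefficients. -/
noncomputable def momentRate (β p δ : ℝ) : ℝ :=
  (1 - p) * Real.log 2 + (p ^ 2 - p) * β ^ 2 / 2 + δ * β * (p - 1) + δ ^ 2 / 2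

/-- Subcriticality enters here: at `δ = 0` the rate is `(p - 1) (p β²/2 - log 2)`, negative for `p`
slightly above `1` since `β²/2 < log 2`. Continuity then allows a small `δ > 0`. -/
theorem exists_momentRate_neg {β : ℝ} (hβ0 : 0 < β) (hβc : β < criticalBeta) :
    ∃ p δ : ℝ, 1 < p ∧ p ≤ 2 ∧ 0 < δ ∧ momentRate β p δ < 0 := by
  have h : β ^ 2 / 2 < Real.log 2 := by
    have := (Real.lt_sqrt hβ0.le).1 hβc
    linarith
  obtain ⟨p, hp1, hp2, hp⟩ : ∃ p : ℝ, 1 < p ∧ p ≤ 2 ∧ p * (β ^ 2 / 2) < Real.log 2 := by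
    have hc : Tendsto (fun p : ℝ => p * (β ^ 2 / 2)) (𝓝[>] 1) (𝓝 (1 * (β ^ 2 / 2))) :=
      ((continuous_id.mul continuous_const).tendsto 1).mono_left nhdsWithin_le_nhds
    rw [one_mul] at hc
    obtain ⟨p, h1, h2, h3⟩ := ((hc.eventually_lt_const h).and
      ((Ioc_mem_nhdsGT (one_lt_two : (1 : ℝ) < 2)))).exists
    exact ⟨p, h2, h3, h1⟩
  have h0 : momentRate β p 0 < 0 := by
    have : momentRate β p 0 = (p - 1) * (p * (β ^ 2 / 2) - Real.log 2) := by
      unfold momentRate; ring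
    rw [this]
    exact mul_neg_of_pos_of_neg (by linarith) (by linarith)
  have hc : Tendsto (fun δ : ℝ => momentRate β p δ) (𝓝[>] 0) (𝓝 (momentRate β p 0)) := by
    have : Continuous fun δ : ℝ => momentRate β p δ := by unfold momentRate; fun_prop
    exact (this.tendsto 0).mono_left nhdsWithin_le_nhds
  obtain ⟨δ, h1, h2⟩ := ((hc.eventually_lt_const h0).and self_mem_nhdsWithin).exists
  exact ⟨p, δ, hp1, hp2, h2, h1⟩

end Parameters

/-! ### Gaussian integrals of the two noises -/

section Noise

variable (β : ℝ)

theorem continuous_tiltNoise : Continuous (tiltNoise β) := by unfold tiltNoise; fun_prop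

theorem continuous_derivNoise : Continuous (derivNoise β) := by unfold derivNoise; fun_prop

theorem exp_tilt_eq (g : ℝ) :
    Real.exp (β * g - β ^ 2 / 2) = Real.exp (-(β ^ 2 / 2)) * Real.exp (β * g) := by
  rw [← Real.exp_add]; ring_nf

theorem integrable_pow_mul_exp (k : ℕ) (t : ℝ) :
    Integrable (fun g : ℝ => g ^ k * Real.exp (t * g)) (gaussianReal 0 1) :=
  integrable_pow_mul_exp_of_mem_interior_integrableExpSet (X := fun g : ℝ => g) (by simp) k

theorem integral_exp_mul (t : ℝ) :
    ∫ g : ℝ, Real.exp (t * g) ∂gaussianReal 0 1 = Real.exp (t ^ 2 / 2) := by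
  have := congrFun (mgf_fun_id_gaussianReal (μ := 0) (v := 1)) t
  simpa [mgf] using this

theorem integral_mul_exp_mul (t : ℝ) :
    ∫ g : ℝ, g * Real.exp (t * g) ∂gaussianReal 0 1 = t * Real.exp (t ^ 2 / 2) := by
  have h := deriv_mgf (X := fun g : ℝ => g) (μ := gaussianReal 0 1) (t := t) (by simp)
  rw [← h, mgf_fun_id_gaussianReal]
  have hd : HasDerivAt (fun s : ℝ => Real.exp (0 * s + ((1 : NNReal) : ℝ) * s ^ 2 / 2))
      (Real.exp (t ^ 2 / 2) * t) t := by
    have : HasDerivAt (fun s : ℝ => s ^ 2 / 2) t t := by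
      have := ((hasDerivAt_pow 2 t).div_const 2)
      simpa using this
    simpa using this.exp
  rw [hd.deriv, mul_comm]

theorem integral_tiltNoise : ∫ g, tiltNoise β g ∂gaussianReal 0 1 = 0 := by
  unfold tiltNoise
  simp_rw [exp_tilt_eq]
  rw [integral_sub _ (integrable_const _), integral_const_mul, integral_exp_mul, ← Real.exp_add]
  · simp
  · simpa using (integrable_pow_mul_exp 0 β).const_mul _

theorem integral_derivNoise : ∫ g, derivNoise β g ∂gaussianReal 0 1 = 0 := by
  have : ∀ g, derivNoise β g = Real.exp (-(β ^ 2 / 2)) *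
      (g * Real.exp (β * g) - β * Real.exp (β * g)) := fun g => by
    rw [derivNoise, exp_tilt_eq]; ring
  simp_rw [this]
  rw [integral_const_mul, integral_sub, integral_const_mul, integral_exp_mul,
    integral_mul_exp_mul, sub_self, mul_zero]
  · simpa using integrable_pow_mul_exp 1 β
  · simpa using (integrable_pow_mul_exp 0 β).const_mul β

theorem memLp_derivNoise : MemLp (derivNoise β) 2 (gaussianReal 0 1) := by
  rw [memLp_two_iff_integrable_sq (continuous_derivNoise β).aestronglyMeasurable]
  have : ∀ g, derivNoise β g ^ 2 = Real.exp (-(β ^ 2)) *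
      (g ^ 2 * Real.exp (2 * β * g) + (-(2 * β)) * (g ^ 1 * Real.exp (2 * β * g)) +
        β ^ 2 * (g ^ 0 * Real.exp (2 * β * g))) := fun g => by
    have e : Real.exp (β * g - β ^ 2 / 2) ^ 2 =
        Real.exp (-(β ^ 2)) * Real.exp (2 * β * g) := by
      rw [← Real.exp_add, ← Real.exp_nat_mul]; push_cast; ring_nf
    rw [derivNoise, mul_pow, e]; ring
  simp_rw [this]
  exact (((integrable_pow_mul_exp 2 _).add ((integrable_pow_mul_exp 1 _).const_mul _)).add
    ((integrable_pow_mul_exp 0 _).const_mul _)).const_mul _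

theorem memLp_tiltNoise : MemLp (tiltNoise β) 2 (gaussianReal 0 1) := by
  refine MemLp.sub ?_ (memLp_const 1)
  rw [memLp_two_iff_integrable_sq (by fun_prop)]
  have : ∀ g, Real.exp (β * g - β ^ 2 / 2) ^ 2 =
        Real.exp (-(β ^ 2)) * (g ^ 0 * Real.exp (2 * β * g)) := fun g => by
    rw [pow_zero, one_mul, ← Real.exp_add, ← Real.exp_nat_mul]; push_cast; ring_nf
  simp_rw [this]
  exact (integrable_pow_mul_exp 0 _).const_mul _

end Noise

/-! ### σ-algebras generated by sets of vertices -/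

section Fields

variable {Ω : Type*} (G : List Bool → Ω → ℝ)

/-- The σ-algebra generated by the increments at the vertices in `S`. -/
abbrev incrementField (S : Set (List Bool)) : MeasurableSpace Ω :=
  ⨆ v ∈ S, MeasurableSpace.comap (G v) inferInstance

theorem measurable_incrementField {S : Set (List Bool)} {v : List Bool} (hv : v ∈ S) :
    Measurable[incrementField G S] (G v) :=
  Measurable.of_comap_le (le_iSup₂_of_le (f := fun v (_ : v ∈ S) =>
    MeasurableSpace.comap (G v) inferInstance) v hv le_rfl)

theorem incrementField_mono {S T : Set (List Bool)} (h : S ⊆ T) :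
    incrementField G S ≤ incrementField G T :=
  iSup₂_le fun v hv => le_iSup₂_of_le (f := fun v (_ : v ∈ T) =>
    MeasurableSpace.comap (G v) inferInstance) v (h hv) le_rfl

/-- The root is excluded on purpose: in the subtree at `b` it corresponds to `[b]`, whose increment
must stay independent of that subtree's limit. -/
theorem measurable_brwValue {m : MeasurableSpace Ω} {N : ℕ}
    (h : ∀ v : List Bool, v ≠ [] → v.length ≤ N → Measurable (G v)) (u : List Bool)
    (hu : u.length ≤ N) : Measurable (brwValue G u) := by
  unfold brwValue
  refine Finset.measurable_sum _ fun k hk => h _ ?_ ?_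
  · rw [Ne, List.take_eq_nil_iff]
    rintro (h | rfl) <;> simp at *
  · exact (List.length_take_le' _ _).trans hu

theorem measurable_childWeight {m : MeasurableSpace Ω} {β : ℝ} {n : ℕ}
    (h : ∀ v : List Bool, v ≠ [] → v.length ≤ n → Measurable (G v)) (u : Fin n → Bool) :
    Measurable (childWeight G β n u) := by
  have := measurable_brwValue G h (List.ofFn u) (by simp)
  unfold childWeight
  fun_prop

theorem measurable_derivMartingale {m : MeasurableSpace Ω} {β : ℝ} {n : ℕ}
    (h : ∀ v : List Bool, v ≠ [] → v.length ≤ n → Measurable (G v)) :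
    Measurable (derivMartingale G β n) := by
  have := fun u : Fin n → Bool => measurable_brwValue G h (List.ofFn u) (by simp)
  unfold derivMartingale
  fun_prop

end Fields

/-! ### Independence and exponential moments along the tree -/

section Tree

variable {Ω : Type*} [mΩ : MeasurableSpace Ω] {P : Measure Ω}
  {G : List Bool → Ω → ℝ} (hG : IsStdGaussianTree P G)

include hG

theorem incrementField_le (S : Set (List Bool)) : incrementField G S ≤ mΩ :=
  iSup₂_le fun v _ => (hG.measurable v).comap_le

theorem indep_incrementField {S T : Set (List Bool)} (h : Disjoint S T) :
    Indep (incrementField G S) (incrementField G T) P :=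
  indep_iSup_of_disjoint (fun v => (hG.measurable v).comap_le) hG.indep.iIndep h

theorem integral_comp_increment {f : ℝ → ℝ} (hf : Continuous f) (v : List Bool) :
    ∫ ω, f (G v ω) ∂P = ∫ g, f g ∂gaussianReal 0 1 := by
  rw [← hG.law v, integral_map (hG.measurable v).aemeasurable hf.aestronglyMeasurable]

theorem memLp_comp_increment {f : ℝ → ℝ} (hf : MemLp f 2 (gaussianReal 0 1)) (v : List Bool) :
    MemLp (fun ω => f (G v ω)) 2 P := by
  rw [← hG.law v] at hf
  exact hf.comp_of_map (hG.measurable v).aemeasurable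

theorem integral_exp_mul_brwValue (t : ℝ) (u : List Bool) :
    ∫ ω, Real.exp (t * brwValue G u ω) ∂P = Real.exp (t ^ 2 / 2 * u.length) := by
  have hinj : Function.Injective fun k : Fin u.length => u.take (k + 1) := by
    intro j k h
    have := congrArg List.length h
    simp only [List.length_take] at this
    have h1 := j.2
    have h2 := k.2
    ext
    omega
  have h := (hG.indep.precomp hinj).mgf_sum (t := t) (fun k => hG.measurable _) Finset.univ
  have h1 : mgf (∑ k : Fin u.length, G (u.take (k + 1))) P t =
      ∫ ω, Real.exp (t * brwValue G u ω) ∂P := by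
    simp only [mgf, brwValue, Finset.sum_apply, Finset.sum_range]
  rw [← h1, h]
  simp_rw [mgf_gaussianReal (hG.law _)]
  rw [← Real.exp_sum]
  simp [mul_comm]

theorem integrable_exp_mul_brwValue (t : ℝ) (u : List Bool) :
    Integrable (fun ω => Real.exp (t * brwValue G u ω)) P := by
  -- A non-integrable function has Bochner integral `0`, whereas the integral just computed is
  -- positive.
  by_contra h
  have h1 := integral_exp_mul_brwValue hG t u
  rw [integral_undef h] at h1
  exact (Real.exp_pos _).ne h1

theorem integral_exp_mul_brwValue_sub (t c : ℝ) {n : ℕ} (u : Fin n → Bool) :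
    ∫ ω, Real.exp (t * brwValue G (List.ofFn u) ω - c * n) ∂P =
      Real.exp ((t ^ 2 / 2 - c) * n) := by
  simp_rw [sub_eq_add_neg, Real.exp_add]
  rw [integral_mul_const, integral_exp_mul_brwValue hG, ← Real.exp_add]
  simp [add_mul]

theorem integrable_exp_mul_brwValue_sub (t c : ℝ) {n : ℕ} (u : Fin n → Bool) :
    Integrable (fun ω => Real.exp (t * brwValue G (List.ofFn u) ω - c * n)) P := by
  simp_rw [sub_eq_add_neg, Real.exp_add]
  exact (integrable_exp_mul_brwValue hG _ _).mul_const _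

end Tree

/-! ### L¹ summability of the increments, the limit and its negativity -/

section Coefficients

variable {Ω : Type*} [mΩ : MeasurableSpace Ω] {P : Measure Ω}
  {G : List Bool → Ω → ℝ}

/-- The coefficients of the noises in the increments of the derivative martingale; `e = 1` for
`tiltNoise` and `e = 0` for `derivNoise`. -/
noncomputable def coeff (G : List Bool → Ω → ℝ) (β : ℝ) (e n : ℕ) (p : (Fin n → Bool) × Bool)
    (ω : Ω) : ℝ :=
  childWeight G β n p.1 ω * (brwValue G (List.ofFn p.1) ω - β * n) ^ e

theorem derivMartingale_succ_sub_eq_coeff {Ω : Type*} (G : List Bool → Ω → ℝ) (β : ℝ) (n : ℕ)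
    (ω : Ω) : derivMartingale G β (n + 1) ω - derivMartingale G β n ω =
      ∑ q, coeff G β 1 n q ω * tiltNoise β (G (child q) ω) +
        ∑ q, coeff G β 0 n q ω * derivNoise β (G (child q) ω) := by
  rw [derivMartingale_succ_sub]
  simp [coeff]

/-- The set of vertices of generations `1, …, n`. -/
def verticesUpTo (n : ℕ) : Set (List Bool) := {v | v ≠ [] ∧ v.length ≤ n}

/-- The set of vertices of generation `n`. -/
def generation (n : ℕ) : Set (List Bool) := {v | v.length = n}

theorem disjoint_verticesUpTo_generation (n : ℕ) :
    Disjoint (verticesUpTo n) (generation (n + 1)) := by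
  rw [Set.disjoint_left]
  rintro v ⟨_, h⟩ (h' : v.length = n + 1)
  omega

theorem child_mem_generation {n : ℕ} (q : (Fin n → Bool) × Bool) : child q ∈ generation (n + 1) :=
  length_child q

theorem verticesUpTo_mono {m n : ℕ} (h : m ≤ n) : verticesUpTo m ⊆ verticesUpTo n :=
  fun _ hv => ⟨hv.1, hv.2.trans h⟩

theorem measurable_coeff_incrementField {Ω : Type*} (G : List Bool → Ω → ℝ) (β : ℝ) (e n : ℕ)
    (q : (Fin n → Bool) × Bool) :
    Measurable[incrementField G (verticesUpTo n)] (coeff G β e n q) := by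
  have h := fun (v : List Bool) (h1 : v ≠ []) (h2 : v.length ≤ n) =>
    measurable_incrementField G (show v ∈ verticesUpTo n from ⟨h1, h2⟩)
  have := measurable_brwValue G h (List.ofFn q.1) (by simp)
  have := measurable_childWeight (β := β) G h q.1
  unfold coeff
  fun_prop

theorem derivMartingale_tendsto_of_summable {Ω : Type*} {G : List Bool → Ω → ℝ} {β : ℝ} {ω : Ω} (k : ℕ)
    (h : Summable fun n => derivMartingale G β (n + 1) ω - derivMartingale G β n ω) :
    Tendsto (fun n => derivMartingale G β n ω) atTop (𝓝 (derivMartingale G β k ω +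
      ∑' n, (derivMartingale G β (n + k + 1) ω - derivMartingale G β (n + k) ω))) := by
  have h' := ((summable_nat_add_iff k).2 h).hasSum.tendsto_sum_nat
  rw [← tendsto_add_atTop_iff_nat k]
  have e : ∀ N, derivMartingale G β (N + k) ω = derivMartingale G β k ω + ∑ n ∈ Finset.range N,
      (derivMartingale G β (n + k + 1) ω - derivMartingale G β (n + k) ω) := fun N => by
    have := Finset.sum_range_sub (fun n => derivMartingale G β (n + k) ω) N
    rw [zero_add] at this
    rw [← sub_eq_iff_eq_add', ← this]
    exact Finset.sum_congr rfl fun n _ => by rw [Nat.add_right_comm]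
  exact (h'.const_add _).congr fun N => (e N).symm

theorem derivMartingale_one_neg {Ω : Type*} {G : List Bool → Ω → ℝ} {β : ℝ} {ω : Ω} (h : ∀ b : Bool, G [b] ω < β) :
    derivMartingale G β 1 ω < 0 := by
  unfold derivMartingale
  refine mul_neg_of_pos_of_neg (by norm_num) (Finset.sum_neg (fun u _ => ?_) Finset.univ_nonempty)
  refine mul_neg_of_pos_of_neg (Real.exp_pos _) ?_
  have := h (u 0)
  simp [brwValue]
  linarith

variable (hG : IsStdGaussianTree P G)

include hG

/-- The two shifted Laplace transforms have rates `(p² - p) β²/2 ± δβ(p - 1) + δ²/2`; the larger one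
is kept for both. -/
theorem integrable_coeff_rpow_and_integral_le {β p δ : ℝ} (hβ : 0 < β) (hp1 : 1 ≤ p) (hp2 : p ≤ 2)
    (hδ : 0 < δ) {e : ℕ} (he : e ≤ 1) (n : ℕ) (q : (Fin n → Bool) × Bool) :
    Integrable (fun ω => |coeff G β e n q ω| ^ p) P ∧
      ∫ ω, |coeff G β e n q ω| ^ p ∂P ≤ (1 / 2 ^ (n + 1) : ℝ) ^ p * (2 * (1 + 2 / δ ^ 2)) *
        Real.exp (((p ^ 2 - p) * β ^ 2 / 2 + δ * β * (p - 1) + δ ^ 2 / 2) * n) := by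
  set c₁ := p * β ^ 2 / 2 + δ * β
  set c₂ := p * β ^ 2 / 2 - δ * β
  set X := brwValue G (List.ofFn q.1)
  set κ := (p ^ 2 - p) * β ^ 2 / 2 + δ * β * (p - 1) + δ ^ 2 / 2 with hκ
  have hi₁ := integrable_exp_mul_brwValue_sub hG (p * β + δ) c₁ q.1
  have hi₂ := integrable_exp_mul_brwValue_sub hG (p * β - δ) c₂ q.1
  set B : Ω → ℝ := fun ω => (1 / 2 ^ (n + 1) : ℝ) ^ p * ((1 + 2 / δ ^ 2) *
    (Real.exp ((p * β + δ) * X ω - c₁ * n) + Real.exp ((p * β - δ) * X ω - c₂ * n))) with hB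
  have hBi : Integrable B P := ((hi₁.add hi₂).const_mul _).const_mul _
  have hle : ∀ ω, |coeff G β e n q ω| ^ p ≤ B ω := fun ω => by
    rw [coeff, childWeight, mul_assoc, abs_mul, Real.mul_rpow (abs_nonneg _) (abs_nonneg _),
      abs_of_nonneg (by positivity : (0 : ℝ) ≤ 1 / 2 ^ (n + 1))]
    exact mul_le_mul_of_nonneg_left (abs_exp_mul_pow_rpow_le hp1 hp2 hδ he β (X ω) n)
      (by positivity)
  have hm : Measurable fun ω => |coeff G β e n q ω| ^ p := by
    have := (measurable_coeff_incrementField G β e n q).mono (incrementField_le hG _) le_rfl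
    exact (continuous_abs.measurable.comp this).pow_const p
  refine ⟨hBi.mono' hm.aestronglyMeasurable (ae_of_all _ fun ω => ?_), ?_⟩
  · rw [Real.norm_of_nonneg (by positivity)]
    exact hle ω
  · refine (integral_mono_of_nonneg (ae_of_all _ fun ω => by positivity) hBi
      (ae_of_all _ hle)).trans ?_
    simp only [hB]
    rw [integral_const_mul, integral_const_mul, integral_add hi₁ hi₂,
      integral_exp_mul_brwValue_sub hG, integral_exp_mul_brwValue_sub hG, mul_assoc]
    refine mul_le_mul_of_nonneg_left ?_ (by positivity)
    rw [mul_comm 2, mul_assoc]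
    refine mul_le_mul_of_nonneg_left ?_ (by positivity)
    have h1 : Real.exp (((p * β + δ) ^ 2 / 2 - c₁) * n) ≤ Real.exp (κ * n) := by
      refine Real.exp_le_exp.2 (mul_le_mul_of_nonneg_right ?_ (Nat.cast_nonneg n))
      simp only [c₁, hκ]; linarith
    have h2 : Real.exp (((p * β - δ) ^ 2 / 2 - c₂) * n) ≤ Real.exp (κ * n) := by
      refine Real.exp_le_exp.2 (mul_le_mul_of_nonneg_right ?_ (Nat.cast_nonneg n))
      have : 0 ≤ δ * β * (p - 1) := by
        have : 0 ≤ p - 1 := by linarith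
        positivity
      simp only [c₂, hκ]; linarith
    linarith

theorem integrable_coeff {β : ℝ} (hβ : 0 < β) {e : ℕ} (he : e ≤ 1) (n : ℕ)
    (q : (Fin n → Bool) × Bool) : Integrable (coeff G β e n q) P := by
  have := (integrable_coeff_rpow_and_integral_le hG hβ le_rfl one_le_two one_pos he n q).1
  simp only [Real.rpow_one] at this
  exact (integrable_norm_iff ((measurable_coeff_incrementField G β e n q).mono
    (incrementField_le hG _) le_rfl).aestronglyMeasurable).1 this

theorem measure_forall_lt_pos (a : ℝ) : 0 < P {ω | ∀ b : Bool, G [b] ω < a} := by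
  have hset : {ω | ∀ b : Bool, G [b] ω < a} = G [false] ⁻¹' Set.Iio a ∩ G [true] ⁻¹' Set.Iio a := by
    ext ω; simp
  have h1 : ∀ b : Bool, P (G [b] ⁻¹' Set.Iio a) ≠ 0 := fun b h => by
    rw [← Measure.map_apply (hG.measurable _) measurableSet_Iio, hG.law] at h
    have := gaussianReal_absolutelyContinuous' 0 one_ne_zero h
    simp at this
  rw [hset, (Indep_iff _ _ _).1 (indep_incrementField hG (S := {[false]}) (T := {[true]}) (by simp))
    _ _ (measurable_incrementField G (Set.mem_singleton _) measurableSet_Iio)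
    (measurable_incrementField G (Set.mem_singleton _) measurableSet_Iio)]
  exact (mul_ne_zero (h1 _) (h1 _)).bot_lt

theorem integrable_noise_sum {β : ℝ} (hβ : 0 < β) {f : ℝ → ℝ} (hf : Continuous f)
    (hf2 : MemLp f 2 (gaussianReal 0 1)) {e : ℕ} (he : e ≤ 1) (n : ℕ)
    (q : (Fin n → Bool) × Bool) :
    Integrable (fun ω => coeff G β e n q ω * f (G (child q) ω)) P := by
  have := hG.indep.isProbabilityMeasure
  exact integrable_mul_of_indep (indep_incrementField hG (disjoint_verticesUpTo_generation n))
    (measurable_coeff_incrementField G β e n q)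
    (hf.measurable.comp (measurable_incrementField G (child_mem_generation q)))
    (integrable_coeff hG hβ he n q) ((memLp_comp_increment hG hf2 _).integrable one_le_two)

theorem integral_abs_noise_sum_le {β : ℝ} (hβ : 0 < β) {f : ℝ → ℝ} (hf : Continuous f)
    (hf2 : MemLp f 2 (gaussianReal 0 1)) (hf0 : ∫ g, f g ∂gaussianReal 0 1 = 0) {e : ℕ}
    (he : e ≤ 1) (n : ℕ) :
    ∫ ω, |∑ q, coeff G β e n q ω * f (G (child q) ω)| ∂P ≤
      (1 + ∫ g, f g * f g ∂gaussianReal 0 1) / 2 * ∫ ω, √(∑ q, coeff G β e n q ω ^ 2) ∂P := by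
  refine integral_abs_sum_mul_le (incrementField_le hG _) (incrementField_le hG _)
    (indep_incrementField hG (disjoint_verticesUpTo_generation n))
    (measurable_coeff_incrementField G β e n) (integrable_coeff hG hβ he n)
    (fun q => hf.measurable.comp (measurable_incrementField G (child_mem_generation q)))
    (fun q => memLp_comp_increment hG hf2 _)
    (fun q => integral_comp_increment hG (hf.mul hf) _) fun q q' hq => ?_
  have := integral_mul_of_indep (P := P) (incrementField_le hG {child q})
    (incrementField_le hG {child q'})
    (indep_incrementField hG (by simpa using (child_injective.ne hq)))
    (hf.measurable.comp (measurable_incrementField G rfl))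
    (hf.measurable.comp (measurable_incrementField G rfl))
  refine this.trans ?_
  simp only [Function.comp_apply]
  rw [integral_comp_increment hG hf, hf0, zero_mul]

theorem integrable_derivMartingale_succ_sub {β : ℝ} (hβ : 0 < β) (n : ℕ) :
    Integrable (fun ω => derivMartingale G β (n + 1) ω - derivMartingale G β n ω) P := by
  simp_rw [derivMartingale_succ_sub_eq_coeff]
  exact (integrable_finsetSum _ fun q _ => integrable_noise_sum hG hβ (continuous_tiltNoise β)
    (memLp_tiltNoise β) le_rfl n q).add (integrable_finsetSum _ fun q _ =>
      integrable_noise_sum hG hβ (continuous_derivNoise β) (memLp_derivNoise β) zero_le_one n q)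

theorem exists_integral_sqrt_coeff_le {β : ℝ} (hβ0 : 0 < β) (hβc : β < criticalBeta) :
    ∃ K r : ℝ, r < 1 ∧ 0 < r ∧ ∀ e ≤ 1, ∀ n : ℕ,
      ∫ ω, √(∑ q, coeff G β e n q ω ^ 2) ∂P ≤ K * r ^ n := by
  have := hG.indep.isProbabilityMeasure
  obtain ⟨p, δ, hp1, hp2, hδ, hneg⟩ := exists_momentRate_neg hβ0 hβc
  set K : ℝ := 2 * (1 + 2 / δ ^ 2)
  have hK : 0 < K := by positivity
  set κ := (p ^ 2 - p) * β ^ 2 / 2 + δ * β * (p - 1) + δ ^ 2 / 2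
  set M := momentRate β p δ with hM
  -- Chosen so that `t = r ^ n` balances the interpolation: `t ^ (1 - p) * exp (M n) = t`.
  set r := Real.exp (M / p) with hr
  have hp0 : 0 < p := by linarith
  refine ⟨1 + K, r, Real.exp_lt_one_iff.2 (div_neg_of_neg_of_pos hneg hp0), Real.exp_pos _,
    fun e he n => ?_⟩
  have hmom := fun q => integrable_coeff_rpow_and_integral_le hG hβ0 hp1.le hp2 hδ he n q
  have hsum : ∑ q : (Fin n → Bool) × Bool, ∫ ω, |coeff G β e n q ω| ^ p ∂P ≤
      K * Real.exp (M * n) := by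
    refine (Finset.sum_le_sum fun q _ => (hmom q).2).trans ?_
    rw [Finset.sum_const, nsmul_eq_mul]
    have hcard : ((Finset.univ : Finset ((Fin n → Bool) × Bool)).card : ℝ) =
        Real.exp ((n + 1) * Real.log 2) := by
      rw [← Nat.cast_add_one, Real.exp_nat_mul, Real.exp_log two_pos]
      simp [pow_succ]
    have hpow : (1 / 2 ^ (n + 1) : ℝ) ^ p = Real.exp (-(p * ((n + 1) * Real.log 2))) := by
      rw [one_div, ← Real.exp_log (two_pos : (0 : ℝ) < 2), ← Real.exp_nat_mul, ← Real.exp_neg,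
        ← Real.exp_mul, Real.log_exp]
      push_cast
      ring_nf
    rw [hcard, hpow]
    -- There are `2 ^ (n + 1)` children while the rate is counted `n` times; the leftover factor `2
    -- ^ (1 - p)` is at most `1`.
    have : Real.exp ((n + 1) * Real.log 2) *
        (Real.exp (-(p * ((n + 1) * Real.log 2))) * K * Real.exp (κ * n)) =
        K * Real.exp ((1 - p) * Real.log 2 + M * n) := by
      rw [mul_comm _ K, mul_assoc, mul_left_comm, ← Real.exp_add, ← Real.exp_add]
      congr 2
      simp only [hM, momentRate, κ]
      ring
    rw [this]
    refine mul_le_mul_of_nonneg_left (Real.exp_le_exp.2 ?_) hK.le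
    have : (1 - p) * Real.log 2 ≤ 0 :=
      mul_nonpos_of_nonpos_of_nonneg (by linarith) (Real.log_pos one_lt_two).le
    linarith
  have ht : 0 < r ^ n := by positivity
  calc ∫ ω, √(∑ q, coeff G β e n q ω ^ 2) ∂P
      ≤ ∫ ω, (r ^ n + (r ^ n) ^ (1 - p) * ∑ q, |coeff G β e n q ω| ^ p) ∂P := by
        refine integral_mono_of_nonneg (ae_of_all _ fun ω => Real.sqrt_nonneg _)
          ((integrable_const _).add
            ((integrable_finsetSum _ fun q _ => (hmom q).1).const_mul _))
          (ae_of_all _ fun ω => sqrt_sum_sq_le _ _ hp1.le hp2 ht)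
    _ = r ^ n + (r ^ n) ^ (1 - p) * ∑ q, ∫ ω, |coeff G β e n q ω| ^ p ∂P := by
        rw [integral_add (integrable_const _)
          ((integrable_finsetSum _ fun q _ => (hmom q).1).const_mul _), integral_const_mul,
          integral_finsetSum _ fun q _ => (hmom q).1]
        simp
    _ ≤ r ^ n + (r ^ n) ^ (1 - p) * (K * Real.exp (M * n)) := by gcongr
    _ = (1 + K) * r ^ n := by
        have : (r ^ n) ^ (1 - p) * Real.exp (M * n) = r ^ n := by
          rw [hr, ← Real.exp_nat_mul, ← Real.exp_mul, ← Real.exp_add]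
          congr 1
          field_simp
          ring
        rw [mul_left_comm, this]; ring

theorem summable_integral_abs_derivMartingale_succ_sub {β : ℝ} (hβ0 : 0 < β)
    (hβc : β < criticalBeta) :
    Summable fun n => ∫ ω, |derivMartingale G β (n + 1) ω - derivMartingale G β n ω| ∂P := by
  obtain ⟨K, r, hr1, hr0, hb⟩ := exists_integral_sqrt_coeff_le hG hβ0 hβc
  set s₁ := (1 + ∫ g, tiltNoise β g * tiltNoise β g ∂gaussianReal 0 1) / 2
  set s₂ := (1 + ∫ g, derivNoise β g * derivNoise β g ∂gaussianReal 0 1) / 2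
  have hs₁ : 0 ≤ s₁ := by
    have : 0 ≤ ∫ g, tiltNoise β g * tiltNoise β g ∂gaussianReal 0 1 :=
      integral_nonneg fun g => mul_self_nonneg _
    positivity
  have hs₂ : 0 ≤ s₂ := by
    have : 0 ≤ ∫ g, derivNoise β g * derivNoise β g ∂gaussianReal 0 1 :=
      integral_nonneg fun g => mul_self_nonneg _
    positivity
  refine Summable.of_nonneg_of_le (fun n => integral_nonneg fun ω => abs_nonneg _) (fun n => ?_)
    ((summable_geometric_of_lt_one hr0.le hr1).mul_left (s₁ * K + s₂ * K))
  have hi₁ := integrable_finsetSum (Finset.univ) fun q (_ : q ∈ Finset.univ) =>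
    integrable_noise_sum hG hβ0 (continuous_tiltNoise β) (memLp_tiltNoise β) le_rfl n q
  have hi₂ := integrable_finsetSum (Finset.univ) fun q (_ : q ∈ Finset.univ) =>
    integrable_noise_sum hG hβ0 (continuous_derivNoise β) (memLp_derivNoise β) zero_le_one n q
  have h₁ := (integral_abs_noise_sum_le hG hβ0 (continuous_tiltNoise β) (memLp_tiltNoise β)
    (integral_tiltNoise β) le_rfl n).trans (mul_le_mul_of_nonneg_left (hb 1 le_rfl n) hs₁)
  have h₂ := (integral_abs_noise_sum_le hG hβ0 (continuous_derivNoise β) (memLp_derivNoise β)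
    (integral_derivNoise β) zero_le_one n).trans
      (mul_le_mul_of_nonneg_left (hb 0 zero_le_one n) hs₂)
  calc ∫ ω, |derivMartingale G β (n + 1) ω - derivMartingale G β n ω| ∂P
      ≤ ∫ ω, (|∑ q, coeff G β 1 n q ω * tiltNoise β (G (child q) ω)| +
          |∑ q, coeff G β 0 n q ω * derivNoise β (G (child q) ω)|) ∂P := by
        refine integral_mono_of_nonneg (ae_of_all _ fun ω => abs_nonneg _)
          (hi₁.abs.add hi₂.abs) (ae_of_all _ fun ω => ?_)
        simp only
        rw [derivMartingale_succ_sub_eq_coeff]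
        exact abs_add_le _ _
    _ ≤ (s₁ * K + s₂ * K) * r ^ n := by
        rw [integral_add hi₁.abs hi₂.abs]
        refine (add_le_add h₁ h₂).trans_eq ?_
        ring

/-- The increments of the derivative martingale after generation `n` are orthogonal to the events
of generations up to `n`. -/
theorem integral_indicator_mul_derivMartingale_succ_sub {β : ℝ} (hβ : 0 < β) {n : ℕ} {A : Set Ω}
    (hA : MeasurableSet[incrementField G (verticesUpTo n)] A) :
    ∫ ω, A.indicator (fun ω => derivMartingale G β (n + 1) ω - derivMartingale G β n ω) ω ∂P =
      0 := by
  have key : ∀ {f : ℝ → ℝ}, Continuous f → MemLp f 2 (gaussianReal 0 1) →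
      ∫ g, f g ∂gaussianReal 0 1 = 0 → ∀ {e : ℕ}, e ≤ 1 → ∀ q : (Fin n → Bool) × Bool,
        ∫ ω in A, coeff G β e n q ω * f (G (child q) ω) ∂P = 0 := by
    intro f hf hf2 hf0 e he q
    rw [← integral_indicator (incrementField_le hG _ _ hA)]
    have h := integral_mul_of_indep (P := P) (incrementField_le hG _) (incrementField_le hG _)
      (indep_incrementField hG (disjoint_verticesUpTo_generation n))
      ((measurable_coeff_incrementField G β e n q).indicator hA)
      (hf.measurable.comp (measurable_incrementField G (child_mem_generation q)))
    simp only [Function.comp_apply] at h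
    rw [integral_comp_increment hG hf, hf0, mul_zero] at h
    rw [← h]
    congr 1
    funext ω
    by_cases hω : ω ∈ A <;> simp [hω]
  rw [integral_indicator (incrementField_le hG _ _ hA)]
  simp_rw [derivMartingale_succ_sub_eq_coeff]
  have h₁ := fun q => integrable_noise_sum hG hβ (continuous_tiltNoise β)
    (memLp_tiltNoise β) le_rfl n q
  have h₂ := fun q => integrable_noise_sum hG hβ (continuous_derivNoise β)
    (memLp_derivNoise β) zero_le_one n q
  rw [integral_add (integrable_finsetSum _ fun q _ => (h₁ q).integrableOn)
    (integrable_finsetSum _ fun q _ => (h₂ q).integrableOn),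
    integral_finsetSum _ fun q _ => (h₁ q).integrableOn,
    integral_finsetSum _ fun q _ => (h₂ q).integrableOn,
    Finset.sum_eq_zero fun q _ => key (continuous_tiltNoise β) (memLp_tiltNoise β)
      (integral_tiltNoise β) le_rfl q,
    Finset.sum_eq_zero fun q _ => key (continuous_derivNoise β) (memLp_derivNoise β)
      (integral_derivNoise β) zero_le_one q, add_zero]

theorem lintegral_tsum_enorm_ne_top {β : ℝ} (hβ0 : 0 < β) (hβc : β < criticalBeta) :
    ∫⁻ ω, ∑' n, ‖derivMartingale G β (n + 1) ω - derivMartingale G β n ω‖ₑ ∂P ≠ ⊤ := by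
  have hs := summable_integral_abs_derivMartingale_succ_sub hG hβ0 hβc
  have hi := integrable_derivMartingale_succ_sub hG hβ0
  rw [lintegral_tsum fun n => (hi n).aestronglyMeasurable.enorm]
  have : ∀ n, ∫⁻ ω, ‖derivMartingale G β (n + 1) ω - derivMartingale G β n ω‖ₑ ∂P =
      ENNReal.ofReal (∫ ω, |derivMartingale G β (n + 1) ω - derivMartingale G β n ω| ∂P) :=
    fun n => (ofReal_integral_norm_eq_lintegral_enorm (hi n)).symm
  simp_rw [this]
  exact hs.tsum_ofReal_ne_top

theorem ae_summable_derivMartingale_succ_sub {β : ℝ} (hβ0 : 0 < β) (hβc : β < criticalBeta) :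
    ∀ᵐ ω ∂P, Summable fun n => derivMartingale G β (n + 1) ω - derivMartingale G β n ω := by
  have hm := fun n => (integrable_derivMartingale_succ_sub hG hβ0 n).aestronglyMeasurable.enorm
  filter_upwards [ae_lt_top' (AEMeasurable.tsum hm)
    (lintegral_tsum_enorm_ne_top hG hβ0 hβc)] with ω hω
  have := ENNReal.summable_toReal hω.ne
  simp only [toReal_enorm] at this
  exact this.of_norm

/-- The martingale property passes to the limit: L¹ summability lets the integral be exchanged with
the sum of later increments, each orthogonal to `A`. -/
theorem integral_indicator_limit_sub {β : ℝ} (hβ0 : 0 < β) (hβc : β < criticalBeta) {Z : Ω → ℝ}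
    (hZ : IsDerivMartingaleLimit P G β Z) {k : ℕ} {A : Set Ω}
    (hA : MeasurableSet[incrementField G (verticesUpTo k)] A) :
    ∫ ω in A, (Z ω - derivMartingale G β k ω) ∂P = 0 := by
  have hAm := incrementField_le hG _ _ hA
  set F : ℕ → Ω → ℝ := fun n => A.indicator
    fun ω => derivMartingale G β (n + k + 1) ω - derivMartingale G β (n + k) ω with hF
  have hFi : ∀ n, Integrable (F n) P := fun n =>
    (integrable_derivMartingale_succ_sub hG hβ0 (n + k)).indicator hAm
  have hFs : Summable fun n => ∫ ω, ‖F n ω‖ ∂P := by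
    refine Summable.of_nonneg_of_le (fun n => integral_nonneg fun ω => norm_nonneg _)
      (fun n => ?_) ((summable_nat_add_iff k).2
        (summable_integral_abs_derivMartingale_succ_sub hG hβ0 hβc))
    exact integral_mono (hFi n).norm (integrable_derivMartingale_succ_sub hG hβ0 (n + k)).abs
      fun ω => norm_indicator_le_norm_self _ _
  have h := hasSum_integral_of_summable_integral_norm hFi hFs
  have h0 : ∀ n, ∫ ω, F n ω ∂P = 0 := fun n =>
    integral_indicator_mul_derivMartingale_succ_sub hG hβ0
      (incrementField_mono G (verticesUpTo_mono (Nat.le_add_left k n)) _ hA)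
  simp_rw [h0] at h
  rw [← integral_indicator hAm, ← h.unique hasSum_zero]
  refine integral_congr_ae ?_
  filter_upwards [ae_summable_derivMartingale_succ_sub hG hβ0 hβc, hZ] with ω hω hZω
  have := tendsto_nhds_unique hZω (derivMartingale_tendsto_of_summable k hω)
  by_cases hωA : ω ∈ A
  · simp [hF, hωA, this]
  · simp [hF, hωA]

theorem exists_measurable_limit {β : ℝ} (hβ0 : 0 < β) (hβc : β < criticalBeta) :
    ∃ Z : Ω → ℝ, Measurable Z ∧ IsDerivMartingaleLimit P G β Z :=
  measurable_limit_of_tendsto_metrizable_ae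
    (fun _ => (measurable_derivMartingale G (fun v _ _ => hG.measurable v)).aemeasurable)
    ((ae_summable_derivMartingale_succ_sub hG hβ0 hβc).mono fun _ h =>
      ⟨_, derivMartingale_tendsto_of_summable 0 h⟩)

theorem integrable_limit_sub {β : ℝ} (hβ0 : 0 < β) (hβc : β < criticalBeta) {Z : Ω → ℝ}
    (hZ : IsDerivMartingaleLimit P G β Z) (k : ℕ) :
    Integrable (fun ω => Z ω - derivMartingale G β k ω) P := by
  have hm := fun n => measurable_derivMartingale G (β := β) (n := n) (fun v _ _ => hG.measurable v)
  refine ⟨(aemeasurable_of_tendsto_metrizable_ae' (fun n => (hm n).aemeasurable) hZ).sub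
    (hm k).aemeasurable |>.aestronglyMeasurable,
      (lintegral_mono_ae ?_).trans_lt (lintegral_tsum_enorm_ne_top hG hβ0 hβc).lt_top⟩
  filter_upwards [ae_summable_derivMartingale_succ_sub hG hβ0 hβc, hZ] with ω hω hZω
  rw [tendsto_nhds_unique hZω (derivMartingale_tendsto_of_summable k hω), add_sub_cancel_left]
  refine enorm_tsum_le_tsum_enorm.trans ?_
  exact ENNReal.tsum_comp_le_tsum_of_injective (add_left_injective k)
    fun n => ‖derivMartingale G β (n + 1) ω - derivMartingale G β n ω‖ₑ

/-- The limit is negative with positive probability. -/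
theorem measure_limit_neg_pos {β : ℝ} (hβ0 : 0 < β) (hβc : β < criticalBeta) {Z : Ω → ℝ}
    (hZ : IsDerivMartingaleLimit P G β Z) : 0 < P {ω | Z ω < 0} := by
  set A := {ω | ∀ b : Bool, G [b] ω < β} with hAdef
  have hA : MeasurableSet[incrementField G (verticesUpTo 1)] A := by
    have hset : A = ⋂ b : Bool, G [b] ⁻¹' Set.Iio β := by ext ω; simp [hAdef]
    rw [hset]
    exact MeasurableSet.iInter fun b =>
      measurable_incrementField G (show [b] ∈ verticesUpTo 1 from ⟨by simp, by simp⟩)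
        measurableSet_Iio
  have hAm := incrementField_le hG _ _ hA
  rw [pos_iff_ne_zero]
  intro h0
  -- If `Z ≥ 0` almost surely, then `Z - Z_1 > 0` on `A` although its integral over `A` vanishes,
  -- forcing `P A = 0`.
  have hpos : ∀ᵐ ω ∂P.restrict A, 0 < Z ω - derivMartingale G β 1 ω := by
    rw [ae_restrict_iff' hAm]
    have : ∀ᵐ ω ∂P, ¬ Z ω < 0 := by rw [ae_iff]; simpa using h0
    filter_upwards [this] with ω hω hωA
    have := derivMartingale_one_neg hωA
    linarith [not_lt.1 hω]
  have h1 := (setIntegral_eq_zero_iff_of_nonneg_ae (hpos.mono fun _ h => h.le)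
    (integrable_limit_sub hG hβ0 hβc hZ 1).integrableOn).1
    (integral_indicator_limit_sub hG hβ0 hβc hZ hA)
  have h2 : ∀ᵐ ω ∂P.restrict A, False := by
    filter_upwards [hpos, h1] with ω h h'
    exact h.ne' h'
  have h3 : P A = 0 := by simpa using h2
  exact (measure_forall_lt_pos hG β).ne' h3

end Coefficients

/-! ### A canonical version of the limit and its recursion -/

section Limit

/-- The pointwise upper limit of the derivative martingale. -/
noncomputable def derivLimsup {Ω : Type*} (G : List Bool → Ω → ℝ) (β : ℝ) (ω : Ω) : ℝ :=
  limsup (fun n => derivMartingale G β n ω) atTop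

/-- The upper limit is used because it is measurable for any σ-algebra carrying the increments, with
no null sets to discard; this gives exact independence of the two subtrees. -/
theorem measurable_derivLimsup {Ω : Type*} {m : MeasurableSpace Ω} {G : List Bool → Ω → ℝ} {β : ℝ}
    (h : ∀ v : List Bool, v ≠ [] → Measurable (G v)) : Measurable (derivLimsup G β) :=
  Measurable.limsup fun _ => measurable_derivMartingale G fun v hv _ => h v hv

/-- The joint law of the increments: the product of standard Gaussian measures. -/
noncomputable def treeLaw : Measure (List Bool → ℝ) :=
  Measure.infinitePi fun _ => gaussianReal 0 1

instance : IsProbabilityMeasure treeLaw := by unfold treeLaw; infer_instance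

/-- The lower tail of the limit of the derivative martingale. -/
noncomputable def lowerTail (β y : ℝ) : ℝ :=
  treeLaw.real {g | derivLimsup (fun v g => g v) β g ≤ -y}

theorem isStdGaussianTree_treeLaw : IsStdGaussianTree treeLaw fun v g => g v where
  measurable v := measurable_pi_apply v
  law v := Measure.infinitePi_map_eval _ v
  indep := iIndepFun_infinitePi (X := fun _ x => x) fun _ => measurable_id

variable {Ω : Type*} [mΩ : MeasurableSpace Ω] {P : Measure Ω}
  {G : List Bool → Ω → ℝ} (hG : IsStdGaussianTree P G)

include hG

theorem map_increments : P.map (fun ω v => G v ω) = treeLaw := by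
  rw [hG.indep.map_fun_eq_infinitePi_map hG.measurable]
  simp_rw [hG.law]
  rfl

theorem isStdGaussianTree_subtree (b : Bool) : IsStdGaussianTree P fun v => G (b :: v) where
  measurable _ := hG.measurable _
  law _ := hG.law _
  indep := hG.indep.precomp (List.cons_injective)

/-- The tail depends only on the joint law of the increments. Hence one function serves the tree and
its subtrees, and the final constants do not depend on the probability space. -/
theorem measureReal_derivLimsup_le (β y : ℝ) :
    P.real {ω | derivLimsup G β ω ≤ -y} = lowerTail β y := by
  have hm : Measurable (derivLimsup (fun (v : List Bool) (g : List Bool → ℝ) => g v) β) :=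
    measurable_derivLimsup fun v _ => measurable_pi_apply v
  rw [lowerTail, ← map_increments hG]
  exact (map_measureReal_apply (measurable_pi_iff.2 hG.measurable) (hm measurableSet_Iic)).symm

theorem isDerivMartingaleLimit_derivLimsup {β : ℝ} (hβ0 : 0 < β) (hβc : β < criticalBeta) :
    IsDerivMartingaleLimit P G β (derivLimsup G β) := by
  obtain ⟨Z, -, hZ⟩ := exists_measurable_limit hG hβ0 hβc
  filter_upwards [hZ] with ω hω
  rwa [derivLimsup, hω.limsup_eq]

theorem ae_derivLimsup_le {β : ℝ} (hβ0 : 0 < β) (hβc : β < criticalBeta) :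
    ∀ᵐ ω ∂P, (∀ b, G [b] ω ≤ β) → derivLimsup G β ω ≤ (1 / 2 : ℝ) * ∑ b : Bool,
      Real.exp (β * G [b] ω - β ^ 2 / 2) * derivLimsup (fun v => G (b :: v)) β ω := by
  have h := fun b => isDerivMartingaleLimit_derivLimsup (isStdGaussianTree_subtree hG b) hβ0 hβc
  filter_upwards [isDerivMartingaleLimit_derivLimsup hG hβ0 hβc, ae_all_iff.2 h] with ω h1 h2 h3
  exact le_of_tendsto_of_tendsto' (h1.comp (tendsto_add_atTop_nat 1))
    ((tendsto_finsetSum _ fun b _ => (h2 b).const_mul _).const_mul _)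
    fun n => derivMartingale_succ_le G β n ω h3

theorem measureReal_derivLimsup_recursion {β : ℝ} (hβ0 : 0 < β) (hβc : β < criticalBeta)
    {y : ℝ} (hy : 0 ≤ y) (ε : ℝ) :
    ∏ b : Bool, ((gaussianReal 0 1).real (Set.Icc (β - ε) β) *
        P.real {ω | derivLimsup (fun v => G (b :: v)) β ω ≤ -y}) ≤
      P.real {ω | derivLimsup G β ω ≤ -(y * Real.exp (β ^ 2 / 2 - β * ε))} := by
  have := hG.indep.isProbabilityMeasure
  set A : Bool → Set Ω := fun b => G [b] ⁻¹' Set.Icc (β - ε) β with hAdef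
  set B : Bool → Set Ω := fun b => {ω | derivLimsup (fun v => G (b :: v)) β ω ≤ -y} with hBdef
  have hA : ∀ b, MeasurableSet[incrementField G {[b]}] (A b) := fun b =>
    measurable_incrementField G (Set.mem_singleton _) measurableSet_Icc
  have hB : ∀ b, MeasurableSet[incrementField G (List.cons b '' {w | w ≠ []})] (B b) := fun b => by
    have : Measurable[incrementField G (List.cons b '' {w | w ≠ []})]
        (derivLimsup (fun v => G (b :: v)) β) :=
      measurable_derivLimsup fun v hv =>
        measurable_incrementField G (Set.mem_image_of_mem (List.cons b) hv)
    exact this measurableSet_Iic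
  have hE : ∀ b, MeasurableSet[incrementField G (Set.range (List.cons b))] (A b ∩ B b) := fun b =>
    MeasurableSet.inter
      (incrementField_mono G (Set.singleton_subset_iff.2 (Set.mem_range_self _)) _ (hA b))
      (incrementField_mono G (Set.image_subset_range _ _) _ (hB b))
  have hAB : ∀ b, P.real (A b ∩ B b) = (gaussianReal 0 1).real (Set.Icc (β - ε) β) *
      P.real (B b) := fun b => by
    have hd : Disjoint {[b]} (List.cons b '' {w | w ≠ []}) := by
      rw [Set.disjoint_singleton_left]
      rintro ⟨w, hw, h⟩
      exact hw (by simpa using h)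
    rw [measureReal_def, (Indep_iff _ _ _).1 (indep_incrementField hG hd) _ _ (hA b) (hB b),
      ENNReal.toReal_mul, ← measureReal_def, ← measureReal_def, ← hG.law [b],
      map_measureReal_apply (hG.measurable _) measurableSet_Icc]
  have hind : P.real ((A true ∩ B true) ∩ (A false ∩ B false)) =
      P.real (A true ∩ B true) * P.real (A false ∩ B false) := by
    have hd : Disjoint (Set.range (List.cons true)) (Set.range (List.cons false)) := by
      rw [Set.disjoint_left]
      rintro _ ⟨w, rfl⟩ ⟨w', h⟩
      simp at h
    rw [measureReal_def, (Indep_iff _ _ _).1 (indep_incrementField hG hd) _ _ (hE _) (hE _),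
      ENNReal.toReal_mul, ← measureReal_def, ← measureReal_def]
  rw [Fintype.prod_bool, ← hAB, ← hAB, ← hind]
  refine ENNReal.toReal_mono (measure_ne_top _ _) (measure_mono_ae ?_)
  filter_upwards [ae_derivLimsup_le hG hβ0 hβc] with ω hω h
  have hmem : ∀ b, ω ∈ A b ∩ B b := Bool.forall_bool.2 ⟨h.2, h.1⟩
  refine (hω fun b => (hmem b).1.2).trans ?_
  have hb : ∀ b, Real.exp (β * G [b] ω - β ^ 2 / 2) * derivLimsup (fun v => G (b :: v)) β ω ≤
      -(y * Real.exp (β ^ 2 / 2 - β * ε)) := fun b => by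
    have h1 : derivLimsup (fun v => G (b :: v)) β ω ≤ -y := (hmem b).2
    have h2 : Real.exp (β ^ 2 / 2 - β * ε) ≤ Real.exp (β * G [b] ω - β ^ 2 / 2) := by
      refine Real.exp_le_exp.2 ?_
      have := mul_le_mul_of_nonneg_left (hmem b).1.1 hβ0.le
      nlinarith
    -- Since `-y ≤ 0`, a larger weight only lowers the product.
    nlinarith [Real.exp_pos (β * G [b] ω - β ^ 2 / 2)]
  rw [Fintype.sum_bool]
  linarith [hb true, hb false]

end Limit

/-! ### Iterating the tail recursion -/

section Tail

theorem lowerTail_recursion {β : ℝ} (hβ0 : 0 < β) (hβc : β < criticalBeta) {y : ℝ} (hy : 0 ≤ y)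
    (ε : ℝ) : ((gaussianReal 0 1).real (Set.Icc (β - ε) β) * lowerTail β y) ^ 2 ≤
      lowerTail β (y * Real.exp (β ^ 2 / 2 - β * ε)) := by
  have h := measureReal_derivLimsup_recursion isStdGaussianTree_treeLaw hβ0 hβc hy ε
  have e := fun b =>
    measureReal_derivLimsup_le (isStdGaussianTree_subtree isStdGaussianTree_treeLaw b) β y
  simp only [e, Fintype.prod_bool] at h
  rw [sq]
  exact h

theorem exists_lowerTail_pos {β : ℝ} (hβ0 : 0 < β) (hβc : β < criticalBeta) :
    ∃ y, 0 < y ∧ 0 < lowerTail β y := by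
  have h := measure_limit_neg_pos isStdGaussianTree_treeLaw hβ0 hβc
    (isDerivMartingaleLimit_derivLimsup isStdGaussianTree_treeLaw hβ0 hβc)
  have hU : {g | derivLimsup (fun (v : List Bool) (g : List Bool → ℝ) => g v) β g < 0} =
      ⋃ n : ℕ, {g | derivLimsup (fun v g => g v) β g ≤ -(1 / ((n : ℝ) + 1))} := by
    ext g
    simp only [Set.mem_ofPred_eq, Set.mem_iUnion]
    constructor
    · intro hg
      obtain ⟨n, hn⟩ := exists_nat_one_div_lt (neg_pos.2 hg)
      exact ⟨n, by linarith⟩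
    · rintro ⟨n, hn⟩
      have : (0 : ℝ) < 1 / ((n : ℝ) + 1) := by positivity
      linarith
  rw [hU] at h
  obtain ⟨n, hn⟩ := exists_measure_pos_of_not_measure_iUnion_null h.ne'
  exact ⟨1 / ((n : ℝ) + 1), by positivity, ENNReal.toReal_pos hn.ne' (measure_ne_top _ _)⟩

theorem exists_le_gaussianReal_Icc {β : ℝ} (hβ0 : 0 < β) :
    ∃ q : ℝ, 0 < q ∧ q ≤ 1 ∧ ∀ ε : ℝ, 0 ≤ ε → ε ≤ 1 →
      q * ε ≤ (gaussianReal 0 1).real (Set.Icc (β - ε) β) := by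
  -- For `ε ≤ 1` the window lies in `[-1, β]`, where `|x| ≤ β + 1`, so this density value is a lower
  -- bound.
  set q := gaussianPDFReal 0 1 (β + 1)
  have h : ∀ ε : ℝ, 0 ≤ ε → ε ≤ 1 → q * ε ≤ (gaussianReal 0 1).real (Set.Icc (β - ε) β) := by
    intro ε h0 h1
    rw [measureReal_def, gaussianReal_apply_eq_integral _ one_ne_zero, ENNReal.toReal_ofReal
      (integral_nonneg fun x => gaussianPDFReal_nonneg _ _ _)]
    have hle : ∀ x ∈ Set.Icc (β - ε) β, q ≤ gaussianPDFReal 0 1 x := fun x hx => by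
      simp only [q, gaussianPDFReal]
      gcongr ?_ * Real.exp ?_
      have h1 : -1 ≤ x := by linarith [hx.1]
      have h2 := hx.2
      simp only [sub_zero]
      gcongr ?_ / _
      nlinarith
    have := setIntegral_ge_of_const_le_real measurableSet_Icc (by simp) hle
      (integrable_gaussianPDFReal 0 1).integrableOn
    simpa [h0] using this
  refine ⟨q, gaussianPDFReal_pos _ _ _ one_ne_zero, ?_, h⟩
  have := (h 1 zero_le_one le_rfl).trans measureReal_le_one
  simpa using this

theorem exists_pow_le_lowerTail {β : ℝ} (hβ0 : 0 < β) (hβc : β < criticalBeta) :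
    ∃ κ θ : ℝ, 0 < κ ∧ 0 < θ ∧ θ ≤ 1 ∧
      ∀ n : ℕ, θ ^ 2 ^ n ≤ lowerTail β (κ * Real.exp (β ^ 2 / 2) ^ n) := by
  obtain ⟨y, hy, hpos⟩ := exists_lowerTail_pos hβ0 hβc
  obtain ⟨q, hq0, hq1, hq⟩ := exists_le_gaussianReal_Icc hβ0
  -- `2 - 2 (1/2) ^ n` is the sum of the window widths `(1/2) ^ k`, `k < n`; it stays below `2`,
  -- which gives `κ = y exp (-2β)`.
  set Y : ℕ → ℝ := fun n => y * Real.exp (β ^ 2 / 2 * n - β * (2 - 2 * (1 / 2) ^ n)) with hY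
  set θ := lowerTail β y * (q ^ 2 / 4) with hθ
  have hθ0 : 0 < θ := by positivity
  -- The left side solves `u (n + 1) = (q 2⁻ⁿ u n)²` exactly, with `u 0 = lowerTail β y`; the extra
  -- factor absorbs the cost of the shrinking windows.
  have hstep : ∀ n : ℕ, θ ^ 2 ^ n * (4 / q ^ 2 * 4 ^ n) ≤ lowerTail β (Y n) := by
    intro n
    induction n with
    | zero =>
      have : Y 0 = y := by simp [hY]
      rw [this, hθ]
      refine le_of_eq ?_
      rw [pow_zero, pow_one, pow_zero, mul_one]
      field_simp
    | succ n ih =>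
      have hYn : Y (n + 1) = Y n * Real.exp (β ^ 2 / 2 - β * (1 / 2) ^ n) := by
        simp only [hY]
        rw [mul_assoc, ← Real.exp_add]
        congr 2
        push_cast
        ring
      rw [hYn]
      refine le_trans ?_ (lowerTail_recursion hβ0 hβc (by positivity) _)
      have h1 := hq ((1 / 2) ^ n) (by positivity) (pow_le_one₀ (by norm_num) (by norm_num))
      refine le_trans (le_of_eq ?_) (pow_le_pow_left₀ (by positivity)
        (mul_le_mul h1 ih (by positivity) measureReal_nonneg) 2)
      have h2 : (2 : ℝ) ^ n * 2 ^ n = 4 ^ n := by rw [← mul_pow]; norm_num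
      rw [pow_succ 2 n, pow_mul, pow_succ 4 n, ← h2, one_div, inv_pow]
      field_simp
  refine ⟨y * Real.exp (-(2 * β)), θ, by positivity, hθ0, ?_, fun n => ?_⟩
  · have h1 : lowerTail β y ≤ 1 := measureReal_le_one
    have h2 : q ^ 2 / 4 ≤ 1 := by nlinarith
    exact mul_le_one₀ h1 (by positivity) h2
  · have h1 : (1 : ℝ) ≤ 4 / q ^ 2 * 4 ^ n := by
      refine one_le_mul_of_one_le_of_one_le ?_ (one_le_pow₀ (by norm_num))
      rw [one_le_div (by positivity)]
      nlinarith
    refine (le_mul_of_one_le_right (by positivity) h1).trans ((hstep n).trans ?_)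
    refine measureReal_mono (fun g hg => le_trans (show _ ≤ -Y n from hg) (neg_le_neg ?_))
    rw [mul_assoc, ← Real.exp_nat_mul, ← Real.exp_add]
    refine mul_le_mul_of_nonneg_left (Real.exp_le_exp.2 ?_) hy.le
    have : 0 ≤ β * (2 * (1 / 2) ^ n) := by positivity
    linarith

theorem exists_le_lowerTail {β : ℝ} (hβ0 : 0 < β) (hβc : β < criticalBeta) :
    ∃ c : ℝ, 0 < c ∧ ∃ C : ℝ, 0 < C ∧ ∀ x : ℝ, 0 ≤ x →
      ∃ y, x < y ∧ C * Real.exp (-c * x ^ ((criticalBeta / β) ^ 2)) ≤ lowerTail β y := by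
  obtain ⟨κ, θ, hκ, hθ0, hθ1, h⟩ := exists_pow_le_lowerTail hβ0 hβc
  set γ := (criticalBeta / β) ^ 2 with hγ
  have hγ0 : 0 < γ := pow_pos (div_pos (hβ0.trans hβc) hβ0) 2
  -- The added `1` keeps `L` positive even if `θ = 1`.
  set L := 1 - Real.log θ with hLdef
  have hL : 0 < L := by linarith [Real.log_nonpos hθ0.le hθ1]
  have hLθ : Real.exp (-L) ≤ θ := by
    rw [← Real.le_log_iff_exp_le hθ0]
    linarith
  set r := Real.exp (β ^ 2 / 2) with hr
  have hr1 : 1 < r := Real.one_lt_exp_iff.2 (by positivity)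
  have hrγ : r ^ γ = 2 := by
    have hc : criticalBeta ^ 2 = 2 * Real.log 2 :=
      Real.sq_sqrt (mul_nonneg zero_le_two (Real.log_pos one_lt_two).le)
    rw [hr, ← Real.exp_mul, hγ, div_pow, hc]
    have : β ^ 2 / 2 * (2 * Real.log 2 / β ^ 2) = Real.log 2 := by field_simp
    rw [this, Real.exp_log two_pos]
  have hbound : ∀ n : ℕ, ∀ M : ℝ, (2 : ℝ) ^ n ≤ M → Real.exp (-L * M) ≤ θ ^ 2 ^ n := fun n M hM => by
    calc Real.exp (-L * M) ≤ Real.exp ((2 ^ n : ℕ) * -L) := by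
          refine Real.exp_le_exp.2 ?_
          push_cast
          nlinarith
      _ = Real.exp (-L) ^ 2 ^ n := Real.exp_nat_mul _ _
      _ ≤ θ ^ 2 ^ n := pow_le_pow_left₀ (Real.exp_pos _).le hLθ _
  -- If `κ r ^ n ≤ x < κ r ^ (n + 1)`, then `2 ^ (n + 1) ≤ 2 (x / κ) ^ γ`, whence `c`. The prefactor
  -- `exp (-L)` covers `x < κ`, where level `0` is used.
  refine ⟨L * (2 * (κ ^ γ)⁻¹), by positivity, Real.exp (-L), Real.exp_pos _, fun x hx => ?_⟩
  rw [← Real.exp_add]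
  have hexp : -L + -(L * (2 * (κ ^ γ)⁻¹)) * x ^ γ = -L * (1 + 2 * (x / κ) ^ γ) := by
    rw [Real.div_rpow hx hκ.le]; ring
  rw [hexp]
  have hxγ : 0 ≤ (x / κ) ^ γ := by positivity
  rcases lt_or_ge x κ with hlt | hge
  · refine ⟨κ * r ^ 0, by simpa using hlt, (hbound 0 _ ?_).trans (h 0)⟩
    rw [pow_zero]
    linarith
  · obtain ⟨n, hn1, hn2⟩ := exists_nat_pow_near ((one_le_div hκ).2 hge) hr1
    refine ⟨κ * r ^ (n + 1), ?_, (hbound (n + 1) _ ?_).trans (h (n + 1))⟩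
    · rwa [div_lt_iff₀' hκ] at hn2
    · have : (2 : ℝ) ^ n ≤ (x / κ) ^ γ := by
        rw [← hrγ, ← Real.rpow_natCast, ← Real.rpow_mul (by positivity), mul_comm,
          Real.rpow_mul (by positivity), Real.rpow_natCast]
        exact Real.rpow_le_rpow (by positivity) hn1 hγ0.le
      rw [pow_succ]
      linarith

end Tail

end GaussianTree

theorem theorem1 (β : ℝ) (hβ0 : 0 < β) (hβc : β < criticalBeta) :
    ∃ c : ℝ, 0 < c ∧ ∃ C : ℝ, 0 < C ∧
      ∀ (Ω : Type u) [MeasurableSpace Ω] (P : MeasureTheory.Measure Ω)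
        [MeasureTheory.IsProbabilityMeasure P] (G : List Bool → Ω → ℝ),
        IsStdGaussianTree P G →
          (∃ Z : Ω → ℝ, Measurable Z ∧ IsDerivMartingaleLimit P G β Z) ∧
          ∀ Z : Ω → ℝ, IsDerivMartingaleLimit P G β Z →
            ∀ x : ℝ, 0 ≤ x →
              C * Real.exp (-c * x ^ ((criticalBeta / β) ^ 2)) ≤ P.real {ω | Z ω < -x} := by
  obtain ⟨c, hc, C, hC, h⟩ := GaussianTree.exists_le_lowerTail hβ0 hβc
  refine ⟨c, hc, C, hC, fun Ω _ P _ G hG =>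
    ⟨GaussianTree.exists_measurable_limit hG hβ0 hβc, fun Z hZ x hx => ?_⟩⟩
  obtain ⟨y, hxy, hy⟩ := h x hx
  refine hy.trans ?_
  -- Any limit `Z` agrees almost surely with the upper limit, and `x < y` turns the bound `≤ -y`
  -- into the strict `< -x`.
  rw [← GaussianTree.measureReal_derivLimsup_le hG β y]
  refine ENNReal.toReal_mono (MeasureTheory.measure_ne_top _ _) (MeasureTheory.measure_mono_ae ?_)
  filter_upwards [hZ, GaussianTree.isDerivMartingaleLimit_derivLimsup hG hβ0 hβc] with ω h1 h2 h3
  have h4 : GaussianTree.derivLimsup G β ω ≤ -y := h3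
  rw [← tendsto_nhds_unique h1 h2] at h4
  exact h4.trans_lt (neg_lt_neg hxy)
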